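/- Let $\Omega\subset\mathbb R^n$ be a bounded open set (for instance a bounded Lipschitz domain, $n=1,2,3$). Let $H^1_0(\Omega)$ be the closure of $C_c^\infty(\Omega)$ in the $H^1$-norm and $H^{-1}(\Omega)=[H^1_0(\Omega)]^*$. For $v\in H^1_0(\Omega)$ let $-\Delta v\in H^{-1}(\Omega)$ be the functional $w\mapsto\langle\nabla v,\nabla w\rangle_{L^2(\Omega)}$, regard $f\in L^2(\Omega)$ as the element $w\mapsto\langle f,w\rangle_{L^2(\Omega)}$ of $H^{-1}(\Omega)$, and put $H^1_\Delta(\Omega)=\{v\in H^1_0(\Omega):\Delta v\in L^2(\Omega)\}$. Let $g_\pm\in H^1_\Delta(\Omega)$ with $g_-<g_+$ almost everywhere in $\Omega$, let $$K_s=\{v\in H^1_0(\Omega): g_-\le v\le g_+ \text{ a.e. in }\Omega\},$$ and assume $0\in K_s$. Let $\overline u\in K_s\cap H^1_\Delta(\Omega)$ and $\varrho>0$, and let $u_\varrho\in K_s$ be the solution of the variational inequality $$\varrho\,\langle\nabla u_\varrho,\nabla(v-u_\varrho)\rangle_{L^2(\Omega)}+\langle u_\varrho,v-u_\varrho\rangle_{L^2(\Omega)}\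 \ge\ \langle\overline u,v-u_\varrho\rangle_{L^2(\Omega)}\qquad\text{for all }v\in K_s .$$ Put $\lambda=-\varrho\Delta u_\varrho+u_\varrho-\overline u\in H^{-1}(\Omega)$ and $\Omega_{s,\pm}=\{x\in\Omega:u_\varrho(x)=g_\pm(x)\}$. Then: 1. $z_\varrho=-\Delta u_\varrho\in L^2(\Omega)$, and hence $\lambda\in L^2(\Omega)$, with $\lambda=\varrho z_\varrho+u_\varrho-\overline u$ in $L^2(\Omega)$. 2. $\|\Delta u_\varrho\|_{L^2(\Omega\setminus(\Omega_{s,+}\cup\Omega_{s,-}))}\le\|\Delta\overline u\|_{L^2(\Omega)}$ for every $\varrho>0$. 3. For almost every $x\in\Omega$: $\lambda(x)=0$ if $g_-(x)<u_\varrho(x)<g_+(x)$; $\lambda(x)\ge0$ if $u_\varrho(x)=g_-(x)$; $\lambda(x)\le0$ if $u_\varrho(x)=g_+(x)$. -/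

import Mathlib

open MeasureTheory TopologicalSpace
open scoped Distributions ENNReal

noncomputable section

namespace ObstacleControl

variable {n : ℕ}

/-- Lebesgue measure on the open set `Ω ⊆ ℝⁿ`. -/
abbrev vol (Ω : Opens (EuclideanSpace ℝ (Fin n))) : Measure (EuclideanSpace ℝ (Fin n)) :=
  (volume : Measure (EuclideanSpace ℝ (Fin n))).restrict (Ω : Set (EuclideanSpace ℝ (Fin n)))

/-- The real Hilbert space `L²(Ω)`. -/
abbrev L2 (Ω : Opens (EuclideanSpace ℝ (Fin n))) : Type :=
  Lp ℝ 2 (vol Ω)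

/-- The real Hilbert space `L²(Ω; ℝⁿ)` of square integrable vector fields. -/
abbrev L2Vec (Ω : Opens (EuclideanSpace ℝ (Fin n))) : Type :=
  Lp (EuclideanSpace ℝ (Fin n)) 2 (vol Ω)

theorem memLp_testFunction (Ω : Opens (EuclideanSpace ℝ (Fin n))) (φ : 𝓓(Ω, ℝ)) :
    MemLp (fun x => φ x) 2 (vol Ω) :=
  (φ.continuous.memLp_of_hasCompactSupport φ.hasCompactSupport).restrict _

theorem memLp_gradient_testFunction (Ω : Opens (EuclideanSpace ℝ (Fin n))) (φ : 𝓓(Ω, ℝ)) :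
    MemLp (fun x => gradient (fun y => φ y) x) 2 (vol Ω) := by
  have h1 : Continuous (fun x => gradient (fun y => φ y) x) :=
    (InnerProductSpace.toDual ℝ (EuclideanSpace ℝ (Fin n))).symm.continuous.comp
      (φ.contDiff.continuous_fderiv (by simp))
  have h2 : HasCompactSupport (fun x => gradient (fun y => φ y) x) :=
    (φ.hasCompactSupport.fderiv (𝕜 := ℝ)).comp_left
      (g := (InnerProductSpace.toDual ℝ (EuclideanSpace ℝ (Fin n))).symm) (map_zero _)
  exact (h1.memLp_of_hasCompactSupport h2).restrict _

/-- The pair `(φ, ∇φ) ∈ L²(Ω) × L²(Ω; ℝⁿ)` given by a test function `φ ∈ C_c^∞(Ω)`. -/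
def testPair (Ω : Opens (EuclideanSpace ℝ (Fin n))) (φ : 𝓓(Ω, ℝ)) :
    WithLp 2 (L2 Ω × L2Vec Ω) :=
  WithLp.toLp 2 ((memLp_testFunction Ω φ).toLp _, (memLp_gradient_testFunction Ω φ).toLp _)

/-- The Sobolev space `H¹₀(Ω)`, the closure of `C_c^∞(Ω)` in the `H¹`-norm. Its elements are the
pairs `(v, ∇v)` of a function and its weak gradient: the closure of the linear space of all
`(φ, ∇φ)`, `φ ∈ C_c^∞(Ω)`, in the Hilbert space `L²(Ω) × L²(Ω; ℝⁿ)`, whose norm is the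
`H¹`-norm `(‖v‖² + ‖∇v‖²)^{1/2}`. -/
def H10 (Ω : Opens (EuclideanSpace ℝ (Fin n))) : Submodule ℝ (WithLp 2 (L2 Ω × L2Vec Ω)) :=
  (Submodule.span ℝ (Set.range (testPair Ω))).topologicalClosure

variable {Ω : Opens (EuclideanSpace ℝ (Fin n))}

/-- The embedding `H¹₀(Ω) → L²(Ω)`. -/
def toL2 : H10 Ω →L[ℝ] L2 Ω :=
  (WithLp.fstL 2 ℝ (L2 Ω) (L2Vec Ω)).comp (H10 Ω).subtypeL

/-- The weak gradient `∇ : H¹₀(Ω) → L²(Ω; ℝⁿ)`. -/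
def grad : H10 Ω →L[ℝ] L2Vec Ω :=
  (WithLp.sndL 2 ℝ (L2 Ω) (L2Vec Ω)).comp (H10 Ω).subtypeL

/-- The dual space `H⁻¹(Ω) = [H¹₀(Ω)]*`. -/
abbrev Hneg1 (Ω : Opens (EuclideanSpace ℝ (Fin n))) : Type :=
  StrongDual ℝ (H10 Ω)

/-- The embedding `L²(Ω) → H⁻¹(Ω)`: `f` acts as `w ↦ ⟨f, w⟩_{L²(Ω)}`. -/
def ofL2 (f : L2 Ω) : Hneg1 Ω :=
  (innerSL ℝ f).comp toL2

/-- The distribution `-Δ v ∈ H⁻¹(Ω)` of `v ∈ H¹₀(Ω)`, `w ↦ ⟨∇v, ∇w⟩_{L²(Ω)}`. -/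
def negLaplacian (v : H10 Ω) : Hneg1 Ω :=
  (innerSL ℝ (grad v)).comp grad

/-- `Δ v = f` with `f ∈ L²(Ω)`, as an identity in `H⁻¹(Ω)`. -/
def HasLaplacian (v : H10 Ω) (f : L2 Ω) : Prop :=
  -negLaplacian v = ofL2 f

/-- The space `H¹_Δ(Ω)` of all `v ∈ H¹₀(Ω)` with `Δ v ∈ L²(Ω)`. -/
def H1Delta (Ω : Opens (EuclideanSpace ℝ (Fin n))) : Set (H10 Ω) :=
  {v | ∃ f : L2 Ω, HasLaplacian v f}

/-- The set `K_s` of all `v ∈ H¹₀(Ω)` with `g₋ ≤ v ≤ g₊` almost everywhere in `Ω`. -/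
def Ks (gminus gplus : H10 Ω) : Set (H10 Ω) :=
  {v | ∀ᵐ x ∂(vol Ω), toL2 gminus x ≤ toL2 v x ∧ toL2 v x ≤ toL2 gplus x}

/-- `u ∈ K_s` solves the variational inequality
`ρ ⟨∇u, ∇(v - u)⟩ + ⟨u, v - u⟩ ≥ ⟨ū, v - u⟩` for all `v ∈ K_s`. -/
def IsStateSolution (ρ : ℝ) (gminus gplus : H10 Ω) (ubar : L2 Ω) (u : H10 Ω) : Prop :=
  u ∈ Ks gminus gplus ∧ ∀ v ∈ Ks gminus gplus,
    inner ℝ ubar (toL2 (v - u)) ≤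
      ρ * inner ℝ (grad u) (grad (v - u)) + inner ℝ (toL2 u) (toL2 (v - u))

/-- The multiplier `λ = -ρ Δ u + u - ū ∈ H⁻¹(Ω)`. -/
def multiplier (ρ : ℝ) (ubar : L2 Ω) (u : H10 Ω) : Hneg1 Ω :=
  ρ • negLaplacian u + ofL2 (toL2 u - ubar)

/-- The active set `{x ∈ Ω : u(x) = g(x)}` (determined up to a null set). -/
def activeSet (g u : H10 Ω) : Set (EuclideanSpace ℝ (Fin n)) :=
  {x | x ∈ Ω ∧ toL2 u x = toL2 g x}

/-- The inactive set `Ω ∖ (Ω₊ ∪ Ω₋)`. -/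
def inactiveSet (gminus gplus u : H10 Ω) : Set (EuclideanSpace ℝ (Fin n)) :=
  (Ω : Set (EuclideanSpace ℝ (Fin n))) \ (activeSet gplus u ∪ activeSet gminus u)

end ObstacleControl

end

/-! The solution `u` minimises the convex energy `ρ/2 ‖∇v‖² + 1/2 ‖v‖² - ⟨ū, v⟩` over `K_s`.
Truncating an arbitrary competitor at obstacles whose Laplacians lie in `L²` raises this energy by
at most an `L²` pairing with the amount cut off (`exists_clamp_energy_le`). Compare `u` with the
truncation of `u + t w`: the part cut off has size at most `t |w|`, so dividing by `t` and letting
`t → 0` bounds `λ(w)` by a multiple of the `L²` norm of `w`. Density of `H¹₀` in `L²` and Riesz then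
give `λ ∈ L²`, hence `Δu ∈ L²`.

Once `λ` is a function, the variational inequality extends to truncations of all `L²` functions.
Testing with the truncation of `u - λ` gives a pointwise nonpositive integrand with nonnegative
integral; it vanishes a.e., which is complementarity. Finally, testing with `ū` yields `‖u - ū‖ ≤ ρ
‖Δū‖`, and on the inactive set `λ = 0` means `Δu = (u - ū)/ρ`.

Truncation needs positive parts in `H¹₀`. The only gradient information used is `‖∇t‖² ≤ ⟨∇s, ∇t⟩`
for `t = s⁺`; it survives weak limits of smooth approximations, so no chain rule for `s⁺` is needed.
-/

/-! ### Weak compactness and a smooth positive part on the real line. -/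

/-- Bounded sequences in a Hilbert space have weakly convergent subfilters. -/
theorem exists_weak_limit {H : Type*} [NormedAddCommGroup H] [InnerProductSpace ℝ H]
    [CompleteSpace H] (t : ℕ → H) (C : ℝ) (ht : ∀ k, ‖t k‖ ≤ C) :
    ∃ (U : Filter ℕ) (t₀ : H), U.NeBot ∧ U ≤ Filter.atTop ∧
      ∀ φ : StrongDual ℝ H, Filter.Tendsto (fun k => φ (t k)) U (nhds (φ t₀)) := by
  let f : ℕ → WeakDual ℝ H := fun k =>
    StrongDual.toWeakDual (InnerProductSpace.toDual ℝ H (t k))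
  have hc := WeakDual.isCompact_closedBall (𝕜 := ℝ) (E := H) 0 C
  have hf : ∀ k, f k ∈ WeakDual.toStrongDual ⁻¹' Metric.closedBall (0 : StrongDual ℝ H) C := by
    intro k
    simp [f, ht k]
  obtain ⟨x, -, hx⟩ := hc.ultrafilter_le_nhds ((Filter.hyperfilter ℕ).map f)
    (Filter.tendsto_principal.2 (Filter.Eventually.of_forall hf))
  have hx' : Filter.Tendsto f (Filter.hyperfilter ℕ) (nhds x) := hx
  -- Banach–Alaoglu along a free ultrafilter replaces the extraction of a subsequence; Riesz carries
  -- the weak-* limit back to `H`.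
  refine ⟨Filter.hyperfilter ℕ, (InnerProductSpace.toDual ℝ H).symm (WeakDual.toStrongDual x),
    inferInstance, Nat.hyperfilter_le_atTop, fun φ => ?_⟩
  obtain ⟨w, rfl⟩ := (InnerProductSpace.toDual ℝ H).surjective φ
  have h := ((WeakDual.eval_continuous w).tendsto x).comp hx'
  have e : (InnerProductSpace.toDual ℝ H w)
      ((InnerProductSpace.toDual ℝ H).symm (WeakDual.toStrongDual x)) = x w := by
    rw [InnerProductSpace.toDual_apply_apply, real_inner_comm,
      InnerProductSpace.toDual_symm_apply]
    rfl
  rw [e]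
  refine h.congr fun k => ?_
  rw [InnerProductSpace.toDual_apply_apply, real_inner_comm]
  rfl

/-- A smooth approximation of the positive part. -/
noncomputable def smoothPos (ε r : ℝ) : ℝ := (r + Real.sqrt (r ^ 2 + ε ^ 2) - ε) / 2

theorem smoothPos_zero {ε : ℝ} (hε : 0 < ε) : smoothPos ε 0 = 0 := by
  simp [smoothPos, Real.sqrt_sq hε.le]

theorem contDiff_smoothPos {ε : ℝ} (hε : 0 < ε) : ContDiff ℝ (⊤ : ℕ∞) (smoothPos ε) := by
  unfold smoothPos
  refine ContDiff.div_const (ContDiff.sub (contDiff_id.add (ContDiff.sqrt ?_ ?_))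
    contDiff_const) _
  · fun_prop
  · intro r
    positivity

theorem abs_smoothPos_sub_le {ε : ℝ} (hε : 0 < ε) (r : ℝ) :
    |smoothPos ε r - max r 0| ≤ ε := by
  have h1 : |r| ≤ Real.sqrt (r ^ 2 + ε ^ 2) := Real.abs_le_sqrt (by nlinarith)
  have h2 : Real.sqrt (r ^ 2 + ε ^ 2) ≤ |r| + ε :=
    Real.sqrt_le_iff.2 ⟨by positivity, by nlinarith [sq_abs r, abs_nonneg r]⟩
  have h3 : max r 0 = (r + |r|) / 2 := by
    rcases le_total r 0 with h | h
    · rw [max_eq_right h, abs_of_nonpos h]; ring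
    · rw [max_eq_left h, abs_of_nonneg h]; ring
  rw [h3, smoothPos, abs_le]
  constructor <;> linarith

theorem deriv_smoothPos_mem {ε : ℝ} (hε : 0 < ε) (r : ℝ) :
    0 ≤ deriv (smoothPos ε) r ∧ deriv (smoothPos ε) r ≤ 1 := by
  have hpos : 0 < r ^ 2 + ε ^ 2 := by positivity
  have hs : 0 < Real.sqrt (r ^ 2 + ε ^ 2) := Real.sqrt_pos.2 hpos
  have h1 : |r| ≤ Real.sqrt (r ^ 2 + ε ^ 2) := Real.abs_le_sqrt (by nlinarith)
  have hd : HasDerivAt (smoothPos ε)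
      ((1 + (2 * r) / (2 * Real.sqrt (r ^ 2 + ε ^ 2))) / 2) r := by
    have h := (((hasDerivAt_id r).pow 2).add_const (ε ^ 2)).sqrt (by simpa using hpos.ne')
    have h' := (((hasDerivAt_id r).add h).sub_const ε).div_const 2
    simpa [smoothPos] using! h'
  rw [hd.deriv, mul_div_mul_left _ _ two_ne_zero]
  have h4 := abs_le.1 h1
  have h5 : -1 ≤ r / Real.sqrt (r ^ 2 + ε ^ 2) := by
    rw [le_div_iff₀ hs]; linarith
  have h6 : r / Real.sqrt (r ^ 2 + ε ^ 2) ≤ 1 := by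
    rw [div_le_iff₀ hs]; linarith
  constructor <;> linarith

/-! ### Test functions as elements of `H¹₀(Ω)` and approximate positive parts. -/

namespace ObstacleControl

variable {n : ℕ} {Ω : Opens (EuclideanSpace ℝ (Fin n))}

theorem exists_smoothPos_testFunction (φ : 𝓓(Ω, ℝ)) {ε : ℝ} (hε : 0 < ε) :
    ∃ ψ : 𝓓(Ω, ℝ), (∀ x, |ψ x - max (φ x) 0| ≤ ε) ∧ ∃ c : EuclideanSpace ℝ (Fin n) → ℝ,
      ∀ x, 0 ≤ c x ∧ c x ≤ 1 ∧
        gradient (fun y => ψ y) x = c x • gradient (fun y => φ y) x := by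
  refine ⟨⟨fun x => smoothPos ε (φ x), (contDiff_smoothPos hε).comp φ.contDiff,
    φ.hasCompactSupport.comp_left (smoothPos_zero hε),
    (closure_mono (Function.support_comp_subset (smoothPos_zero hε) φ)).trans
      φ.tsupport_subset⟩, fun x => abs_smoothPos_sub_le hε _,
    fun x => deriv (smoothPos ε) (φ x), fun x => ⟨(deriv_smoothPos_mem hε _).1,
      (deriv_smoothPos_mem hε _).2, ?_⟩⟩
  have h1 : HasDerivAt (smoothPos ε) (deriv (smoothPos ε) (φ x)) (φ x) :=
    ((contDiff_smoothPos hε).differentiable (by simp) _).hasDerivAt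
  have h2 : HasFDerivAt (fun y => φ y) (fderiv ℝ (fun y => φ y) x) x :=
    (φ.contDiff.differentiable (by simp) x).hasFDerivAt
  have h3 := (h1.comp_hasFDerivAt x h2).fderiv
  change (InnerProductSpace.toDual ℝ _).symm (fderiv ℝ (smoothPos ε ∘ fun y => φ y) x) =
    _ • (InnerProductSpace.toDual ℝ _).symm (fderiv ℝ (fun y => φ y) x)
  rw [h3, map_smul]

instance : CompleteSpace (H10 Ω) :=
  (Submodule.isClosed_topologicalClosure _).completeSpace_coe

/-- A test function as an element of `H¹₀(Ω)`. -/
noncomputable def testElement (φ : 𝓓(Ω, ℝ)) : H10 Ω :=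
  ⟨testPair Ω φ, Submodule.le_topologicalClosure _ (Submodule.subset_span ⟨φ, rfl⟩)⟩

theorem gradient_add_testFunction (φ ψ : 𝓓(Ω, ℝ)) :
    (fun x => gradient (fun y => (φ + ψ) y) x) =
      (fun x => gradient (fun y => φ y) x) + fun x => gradient (fun y => ψ y) x := by
  ext1 x
  have h1 : DifferentiableAt ℝ (fun y => φ y) x := φ.contDiff.differentiable (by simp) x
  have h2 : DifferentiableAt ℝ (fun y => ψ y) x := ψ.contDiff.differentiable (by simp) x
  change (InnerProductSpace.toDual ℝ _).symm (fderiv ℝ ((fun y => φ y) + fun y => ψ y) x) = _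
  rw [fderiv_add h1 h2, map_add]
  rfl

theorem gradient_smul_testFunction (c : ℝ) (φ : 𝓓(Ω, ℝ)) :
    (fun x => gradient (fun y => (c • φ) y) x) =
      c • fun x => gradient (fun y => φ y) x := by
  ext1 x
  have h1 : DifferentiableAt ℝ (fun y => φ y) x := φ.contDiff.differentiable (by simp) x
  change (InnerProductSpace.toDual ℝ _).symm (fderiv ℝ (c • fun y => φ y) x) = _
  rw [fderiv_const_smul h1, map_smul]
  rfl

theorem testPair_add (φ ψ : 𝓓(Ω, ℝ)) : testPair Ω (φ + ψ) = testPair Ω φ + testPair Ω ψ := by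
  unfold testPair
  rw [← WithLp.toLp_add, Prod.mk_add_mk, ← MemLp.toLp_add, ← MemLp.toLp_add]
  congr 2
  exact MemLp.toLp_congr _ _ (by rw [gradient_add_testFunction])

theorem testPair_smul (c : ℝ) (φ : 𝓓(Ω, ℝ)) : testPair Ω (c • φ) = c • testPair Ω φ := by
  unfold testPair
  rw [← WithLp.toLp_smul, Prod.smul_mk, ← MemLp.toLp_const_smul, ← MemLp.toLp_const_smul]
  congr 2
  exact MemLp.toLp_congr _ _ (by rw [gradient_smul_testFunction])

/-- Test pairs already form a subspace, so elements of `H¹₀` are limits of single test functions. -/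
theorem mem_span_testPair {v : WithLp 2 (L2 Ω × L2Vec Ω)}
    (hv : v ∈ Submodule.span ℝ (Set.range (testPair Ω))) : ∃ φ, testPair Ω φ = v := by
  induction hv using Submodule.span_induction with
  | mem x hx => exact hx
  | zero => exact ⟨0, by simpa using testPair_smul (Ω := Ω) 0 0⟩
  | add x y _ _ hx hy =>
    obtain ⟨φ, rfl⟩ := hx
    obtain ⟨ψ, rfl⟩ := hy
    exact ⟨φ + ψ, testPair_add φ ψ⟩
  | smul c x _ hx =>
    obtain ⟨φ, rfl⟩ := hx
    exact ⟨c • φ, testPair_smul c φ⟩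

theorem exists_testElement_near (s : H10 Ω) {ε : ℝ} (hε : 0 < ε) :
    ∃ φ : 𝓓(Ω, ℝ), ‖testElement φ - s‖ < ε := by
  have hs : (s : WithLp 2 (L2 Ω × L2Vec Ω)) ∈
      closure (Submodule.span ℝ (Set.range (testPair Ω)) : Set _) := s.2
  obtain ⟨b, hb, hd⟩ := Metric.mem_closure_iff.1 hs ε hε
  obtain ⟨φ, rfl⟩ := mem_span_testPair hb
  refine ⟨φ, ?_⟩
  rw [dist_comm, dist_eq_norm] at hd
  exact hd

theorem norm_le_toL2_add_grad (v : H10 Ω) : ‖v‖ ≤ ‖toL2 v‖ + ‖grad v‖ := by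
  have h : ‖v‖ ^ 2 = ‖toL2 v‖ ^ 2 + ‖grad v‖ ^ 2 := WithLp.prod_norm_sq_eq_of_L2 _
  nlinarith [norm_nonneg v, norm_nonneg (toL2 v), norm_nonneg (grad v)]

theorem toL2_testElement_ae (φ : 𝓓(Ω, ℝ)) : toL2 (testElement φ) =ᵐ[vol Ω] fun x => φ x :=
  MemLp.coeFn_toLp (memLp_testFunction Ω φ)

theorem grad_testElement_ae (φ : 𝓓(Ω, ℝ)) :
    grad (testElement φ) =ᵐ[vol Ω] fun x => gradient (fun y => φ y) x :=
  MemLp.coeFn_toLp (memLp_gradient_testFunction Ω φ)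

theorem coeFn_posPart (f : L2 Ω) : (f⁺ : L2 Ω) =ᵐ[vol Ω] fun x => max (f x) 0 := by
  rw [posPart_def]
  filter_upwards [Lp.coeFn_sup f 0, Lp.coeFn_zero ℝ 2 (vol Ω)] with x h1 h2
  rw [h1, Pi.sup_apply, h2]
  rfl

/-- Uniform closeness becomes `L²` closeness because `Ω` has finite measure. The gradient inequality
is `c² |∇φ|² ≤ c |∇φ|²`, valid since the chain-rule factor `c` lies in `[0, 1]`. -/
theorem exists_approx_posPart (hΩ : Bornology.IsBounded (Ω : Set (EuclideanSpace ℝ (Fin n))))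
    (φ : 𝓓(Ω, ℝ)) {ε : ℝ} (hε : 0 < ε) :
    ∃ t : H10 Ω, ‖toL2 t - (toL2 (testElement φ))⁺‖ ≤
        (volume (Ω : Set (EuclideanSpace ℝ (Fin n)))).toReal ^ ((2 : ℝ)⁻¹) * ε ∧
      inner ℝ (grad t) (grad t) ≤ inner ℝ (grad (testElement φ)) (grad t) := by
  obtain ⟨ψ, h1, c, h2⟩ := exists_smoothPos_testFunction φ hε
  have hfin : IsFiniteMeasure (vol Ω) := ⟨by simpa using hΩ.measure_lt_top⟩
  refine ⟨testElement ψ, ?_, ?_⟩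
  · have h := Lp.norm_le_of_ae_bound (μ := vol Ω)
      (f := toL2 (testElement ψ) - (toL2 (testElement φ))⁺) hε.le (by
        filter_upwards [Lp.coeFn_sub (toL2 (testElement ψ)) ((toL2 (testElement φ))⁺),
          toL2_testElement_ae ψ, toL2_testElement_ae φ,
          coeFn_posPart (toL2 (testElement φ))] with x e1 e2 e3 e4
        rw [e1, Pi.sub_apply, e2, e4, e3]
        exact h1 x)
    simpa [measureUnivNNReal, ENNReal.coe_toNNReal_eq_toReal] using h
  · rw [L2.inner_def, L2.inner_def]
    refine integral_mono_ae (L2.integrable_inner _ _) (L2.integrable_inner _ _) ?_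
    filter_upwards [grad_testElement_ae ψ, grad_testElement_ae φ] with x e1 e2
    obtain ⟨c0, c1, hc⟩ := h2 x
    rw [e1, e2, hc, real_inner_smul_left]
    refine mul_le_of_le_one_left ?_ c1
    rw [real_inner_smul_right]
    exact mul_nonneg c0 real_inner_self_nonneg

end ObstacleControl

/-! ### Positive parts in `H¹₀(Ω)`. -/

namespace ObstacleControl

variable {n : ℕ} {Ω : Opens (EuclideanSpace ℝ (Fin n))}

open Filter Topology in
/-- The positive part of a function in `H¹₀(Ω)` lies in `H¹₀(Ω)`. -/
theorem exists_posPart (hΩ : Bornology.IsBounded (Ω : Set (EuclideanSpace ℝ (Fin n))))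
    (s : H10 Ω) :
    ∃ t : H10 Ω, toL2 t = (toL2 s)⁺ ∧ inner ℝ (grad t) (grad t) ≤ inner ℝ (grad s) (grad t) := by
  have hpos : ∀ k : ℕ, (0 : ℝ) < 1 / ((k : ℝ) + 1) := fun k => Nat.one_div_pos_of_nat
  have hlim : Tendsto (fun k : ℕ => 1 / ((k : ℝ) + 1)) atTop (𝓝 0) :=
    tendsto_one_div_add_atTop_nhds_zero_nat
  choose φ hφ using fun k : ℕ => exists_testElement_near s (hpos k)
  choose t ht1 ht2 using fun k : ℕ => exists_approx_posPart hΩ (φ k) (hpos k)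
  have hφs : Tendsto (fun k => testElement (φ k)) atTop (𝓝 s) := by
    rw [tendsto_iff_norm_sub_tendsto_zero]
    exact squeeze_zero (fun _ => norm_nonneg _) (fun k => (hφ k).le) hlim
  have hφg : Tendsto (fun k => grad (testElement (φ k))) atTop (𝓝 (grad s)) :=
    (grad.continuous.tendsto s).comp hφs
  have hφp : Tendsto (fun k => (toL2 (testElement (φ k)))⁺) atTop (𝓝 (toL2 s)⁺) :=
    ((continuous_posPart.comp toL2.continuous).tendsto s).comp hφs
  have htp : Tendsto (fun k => toL2 (t k)) atTop (𝓝 (toL2 s)⁺) := by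
    have h0 : Tendsto (fun k => toL2 (t k) - (toL2 (testElement (φ k)))⁺) atTop (𝓝 0) := by
      rw [tendsto_zero_iff_norm_tendsto_zero]
      refine squeeze_zero (fun _ => norm_nonneg _) ht1 ?_
      simpa using hlim.const_mul _
    simpa using h0.add hφp
  obtain ⟨C₁, hC₁⟩ := (Metric.isBounded_range_of_tendsto _ htp).exists_norm_le
  obtain ⟨C₂, hC₂⟩ := (Metric.isBounded_range_of_tendsto _ hφg).exists_norm_le
  have hgt : ∀ k, ‖grad (t k)‖ ≤ C₂ := by
    intro k
    refine le_trans ?_ (hC₂ _ ⟨k, rfl⟩)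
    have h1 := (ht2 k).trans (real_inner_le_norm _ _)
    rw [real_inner_self_eq_norm_sq] at h1
    by_contra! h2
    nlinarith [norm_nonneg (grad (testElement (φ k)))]
  obtain ⟨U, t₀, hU, hUle, hw⟩ := exists_weak_limit t (C₁ + C₂) fun k =>
    (norm_le_toL2_add_grad _).trans (add_le_add (hC₁ _ ⟨k, rfl⟩) (hgt k))
  refine ⟨t₀, ?_, ?_⟩
  · refine ext_inner_left ℝ fun f => ?_
    refine tendsto_nhds_unique (hw ((innerSL ℝ f).comp toL2)) ?_
    exact (((innerSL ℝ f).continuous.tendsto _).comp htp).mono_left hUle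
  · have e1 := hw ((innerSL ℝ (grad t₀)).comp grad)
    have e2 := hw ((innerSL ℝ (grad s)).comp grad)
    have e3 : Tendsto (fun k => ‖grad (testElement (φ k)) - grad s‖ * C₂) U (𝓝 0) := by
      have h := (tendsto_iff_norm_sub_tendsto_zero.1 hφg).mul_const C₂
      rw [zero_mul] at h
      exact h.mono_left hUle
    -- Weak lower semicontinuity by linearisation: `2⟨∇t₀, ∇t_k⟩ - ‖∇t₀‖² ≤ ‖∇t_k‖²`, whose left
    -- side is affine in `t_k`.
    have e4 := le_of_tendsto_of_tendsto ((e1.const_mul 2).sub_const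
      (inner ℝ (grad t₀) (grad t₀))) (e2.add e3) (Eventually.of_forall fun k => ?_)
    · simp only [ContinuousLinearMap.comp_apply, innerSL_apply_apply] at e4
      linarith
    · simp only [ContinuousLinearMap.comp_apply, innerSL_apply_apply]
      have h1 : 0 ≤ inner ℝ (grad (t k) - grad t₀) (grad (t k) - grad t₀) :=
        real_inner_self_nonneg
      have h2 : inner ℝ (grad (testElement (φ k)) - grad s) (grad (t k)) ≤
          ‖grad (testElement (φ k)) - grad s‖ * C₂ :=
        (real_inner_le_norm _ _).trans (mul_le_mul_of_nonneg_left (hgt k) (norm_nonneg _))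
      have h3 := ht2 k
      have h4 := real_inner_comm (grad (t k)) (grad t₀)
      simp only [inner_sub_left, inner_sub_right] at h1 h2
      linarith

/-! ### Density in `L²(Ω)` and order in `L²(Ω)`. -/

/-- A function orthogonal to the range integrates to zero against every test function, so it
vanishes by the fundamental lemma of the calculus of variations. -/
theorem denseRange_toL2 : DenseRange (toL2 : H10 Ω → L2 Ω) := by
  have h : (LinearMap.range (toL2 : H10 Ω →L[ℝ] L2 Ω).toLinearMap).topologicalClosure = ⊤ := by
    rw [Submodule.topologicalClosure_eq_top_iff, Submodule.eq_bot_iff]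
    intro f hf
    have h0 : ∀ᵐ x ∂(volume : Measure (EuclideanSpace ℝ (Fin n))),
        x ∈ (Ω : Set (EuclideanSpace ℝ (Fin n))) → f x = 0 := by
      refine Ω.isOpen.ae_eq_zero_of_integral_contDiff_smul_eq_zero ?_ fun g g1 g2 g3 => ?_
      · have hl : LocallyIntegrable f (vol Ω) := (Lp.memLp f).locallyIntegrable (by norm_num)
        exact locallyIntegrableOn_of_locallyIntegrable_restrict hl
      · have h1 := (Submodule.mem_orthogonal _ f).1 hf (toL2 (testElement ⟨g, g1, g2, g3⟩))
          ⟨_, rfl⟩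
        rw [L2.inner_def] at h1
        have h2 : ∫ x in (Ω : Set (EuclideanSpace ℝ (Fin n))), g x • f x = 0 := by
          rw [← h1]
          refine integral_congr_ae ?_
          filter_upwards [toL2_testElement_ae (Ω := Ω) ⟨g, g1, g2, g3⟩] with x hx
          rw [hx]
          simp [mul_comm]
        rw [← h2]
        refine (setIntegral_eq_integral_of_forall_compl_eq_zero fun x hx => ?_).symm
        rw [image_eq_zero_of_notMem_tsupport fun hx' => hx (g3 hx'), zero_smul]
    refine Lp.eq_zero_iff_ae_eq_zero.2 ?_
    exact (ae_restrict_iff' Ω.isOpen.measurableSet).2 h0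
  intro f
  have hf : f ∈ (LinearMap.range
    (toL2 : H10 Ω →L[ℝ] L2 Ω).toLinearMap).topologicalClosure := by rw [h]; trivial
  exact hf

theorem inner_nonneg_of_nonneg {f g : L2 Ω} (hf : 0 ≤ f) (hg : 0 ≤ g) : 0 ≤ inner ℝ f g := by
  rw [L2.inner_def]
  refine integral_nonneg_of_ae ?_
  filter_upwards [(Lp.coeFn_nonneg f).2 hf, (Lp.coeFn_nonneg g).2 hg] with x h1 h2
  exact mul_nonneg h2 h1

theorem inner_posPart_self (f : L2 Ω) : inner ℝ f⁺ f⁺ = inner ℝ f f⁺ := by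
  rw [L2.inner_def, L2.inner_def]
  refine integral_congr_ae ?_
  filter_upwards [coeFn_posPart f] with x hx
  rw [hx]
  rcases le_total (f x) 0 with h | h <;> simp [h]

theorem inner_le_inner_posPart (f : L2 Ω) {g : L2 Ω} (hg : 0 ≤ g) :
    inner ℝ f g ≤ inner ℝ f⁺ g := by
  have h := inner_nonneg_of_nonneg (sub_nonneg.2 (le_posPart f)) hg
  rw [inner_sub_left] at h
  linarith

theorem mem_Ks_iff {g₁ g₂ v : H10 Ω} :
    v ∈ Ks g₁ g₂ ↔ toL2 g₁ ≤ toL2 v ∧ toL2 v ≤ toL2 g₂ := by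
  rw [← Lp.coeFn_le, ← Lp.coeFn_le]
  unfold Ks Filter.EventuallyLE
  rw [← Filter.eventually_and]
  rfl

/-! ### Energy and its change under truncation. -/

/-- The energy `ρ/2 ‖∇v‖² + 1/2 ‖v‖² - ⟨f, v⟩` of the obstacle problem. -/
noncomputable def energy (ρ : ℝ) (f : L2 Ω) (v : H10 Ω) : ℝ :=
  ρ / 2 * inner ℝ (grad v) (grad v) + 1 / 2 * inner ℝ (toL2 v) (toL2 v) - inner ℝ f (toL2 v)

theorem multiplier_apply (ρ : ℝ) (f : L2 Ω) (v w : H10 Ω) :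
    multiplier ρ f v w = ρ * inner ℝ (grad v) (grad w) +
      (inner ℝ (toL2 v) (toL2 w) - inner ℝ f (toL2 w)) := by
  rw [← inner_sub_left]
  rfl

theorem energy_add (ρ : ℝ) (f : L2 Ω) (v w : H10 Ω) :
    energy ρ f (v + w) = energy ρ f v + multiplier ρ f v w +
      (ρ / 2 * inner ℝ (grad w) (grad w) + 1 / 2 * inner ℝ (toL2 w) (toL2 w)) := by
  have h1 := real_inner_comm (grad v) (grad w)
  have h2 := real_inner_comm (toL2 v) (toL2 w)
  simp only [energy, multiplier_apply, map_add, inner_add_left, inner_add_right, h1, h2]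
  ring

theorem energy_neg (ρ : ℝ) (f : L2 Ω) (v : H10 Ω) : energy ρ (-f) (-v) = energy ρ f v := by
  simp [energy]

theorem inner_grad_of_hasLaplacian {g : H10 Ω} {p : L2 Ω} (hg : HasLaplacian g p) (w : H10 Ω) :
    inner ℝ (grad g) (grad w) = -inner ℝ p (toL2 w) := by
  have h := congrArg (fun F : Hneg1 Ω => F w) hg
  simp only [negLaplacian, ofL2, neg_apply,
    ContinuousLinearMap.comp_apply, innerSL_apply_apply] at h
  linarith

/-- Take `w = v + t` with `t = (g - v)⁺`. In the first-order term, `∇v` and `v` may be traded for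
`∇g` and `g` at the price of `-ρ‖∇t‖² - ‖t‖²`, which absorbs the quadratic term. What remains is `⟨g
- f - ρ p, t⟩`, and `t ≥ 0` allows passing to the positive part. -/
theorem exists_sup_energy_le (hΩ : Bornology.IsBounded (Ω : Set (EuclideanSpace ℝ (Fin n))))
    {ρ : ℝ} (hρ : 0 < ρ) (f : L2 Ω) {g : H10 Ω} {p : L2 Ω} (hg : HasLaplacian g p) (v : H10 Ω) :
    ∃ w : H10 Ω, toL2 w = toL2 v ⊔ toL2 g ∧
      energy ρ f w ≤ energy ρ f v +
        inner ℝ (toL2 g - f - ρ • p)⁺ (toL2 g - toL2 v)⁺ := by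
  obtain ⟨t, ht1, ht2⟩ := exists_posPart hΩ (g - v)
  rw [map_sub] at ht1
  refine ⟨v + t, ?_, ?_⟩
  · rw [map_add, ht1, sup_comm, sup_eq_add_posPart_sub]
  · rw [energy_add, ← ht1]
    have h1 := inner_le_inner_posPart (toL2 g - f - ρ • p) (g := toL2 t)
      (ht1 ▸ posPart_nonneg _)
    have h2 := inner_posPart_self (toL2 g - toL2 v)
    rw [← ht1] at h2
    have h3 := inner_grad_of_hasLaplacian hg t
    have h4 : 0 ≤ inner ℝ (toL2 t) (toL2 t) := real_inner_self_nonneg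
    have h5 : 0 ≤ inner ℝ (grad t) (grad t) := real_inner_self_nonneg
    simp only [multiplier_apply, map_sub, inner_sub_left, real_inner_smul_left] at *
    nlinarith [mul_le_mul_of_nonneg_left ht2 hρ.le, mul_nonneg hρ.le h5]

theorem HasLaplacian.neg {g : H10 Ω} {p : L2 Ω} (hg : HasLaplacian g p) :
    HasLaplacian (-g) (-p) := by
  ext w
  have h := inner_grad_of_hasLaplacian hg w
  simp [negLaplacian, ofL2, h]

/-- The upper obstacle is the lower one after changing the sign of `f`, `g` and `v`. -/
theorem exists_inf_energy_le (hΩ : Bornology.IsBounded (Ω : Set (EuclideanSpace ℝ (Fin n))))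
    {ρ : ℝ} (hρ : 0 < ρ) (f : L2 Ω) {g : H10 Ω} {p : L2 Ω} (hg : HasLaplacian g p) (v : H10 Ω) :
    ∃ w : H10 Ω, toL2 w = toL2 v ⊓ toL2 g ∧
      energy ρ f w ≤ energy ρ f v +
        inner ℝ (f - toL2 g + ρ • p)⁺ (toL2 v - toL2 g)⁺ := by
  obtain ⟨w, h1, h2⟩ := exists_sup_energy_le hΩ hρ (-f) hg.neg (-v)
  refine ⟨-w, by rw [map_neg, h1, map_neg, map_neg, neg_sup, neg_neg, neg_neg], ?_⟩
  rw [← energy_neg ρ f v, ← energy_neg ρ f (-w), neg_neg]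
  convert h2 using 4
  · rw [map_neg, smul_neg]; abel
  · rw [map_neg, map_neg]; abel

theorem exists_clamp_energy_le (hΩ : Bornology.IsBounded (Ω : Set (EuclideanSpace ℝ (Fin n))))
    {ρ : ℝ} (hρ : 0 < ρ) (f : L2 Ω) {g₁ g₂ : H10 Ω} {p₁ p₂ : L2 Ω} (h₁ : HasLaplacian g₁ p₁)
    (h₂ : HasLaplacian g₂ p₂) (v : H10 Ω) :
    ∃ w : H10 Ω, toL2 w = (toL2 v ⊔ toL2 g₁) ⊓ toL2 g₂ ∧
      energy ρ f w ≤ energy ρ f v +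
        inner ℝ (toL2 g₁ - f - ρ • p₁)⁺ (toL2 g₁ - toL2 v)⁺ +
        inner ℝ (f - toL2 g₂ + ρ • p₂)⁺ (toL2 v ⊔ toL2 g₁ - toL2 g₂)⁺ := by
  obtain ⟨w₁, a1, a2⟩ := exists_sup_energy_le hΩ hρ f h₁ v
  obtain ⟨w₂, b1, b2⟩ := exists_inf_energy_le hΩ hρ f h₂ w₁
  rw [a1] at b1 b2
  exact ⟨w₂, b1, by linarith⟩

theorem IsStateSolution.energy_le {ρ : ℝ} (hρ : 0 < ρ) {g₁ g₂ u v : H10 Ω} {f : L2 Ω}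
    (hu : IsStateSolution ρ g₁ g₂ f u) (hv : v ∈ Ks g₁ g₂) : energy ρ f u ≤ energy ρ f v := by
  have h1 := energy_add ρ f u (v - u)
  have h2 := hu.2 v hv
  have h3 : 0 ≤ inner ℝ (toL2 (v - u)) (toL2 (v - u)) := real_inner_self_nonneg
  have h4 : 0 ≤ inner ℝ (grad (v - u)) (grad (v - u)) := real_inner_self_nonneg
  rw [add_sub_cancel] at h1
  have h5 := multiplier_apply ρ f u (v - u)
  nlinarith [mul_nonneg hρ.le h4]

/-! ### The multiplier is a function in `L²(Ω)`. -/

theorem nonneg_of_forall_pos_add_mul {a b : ℝ} (hb : 0 ≤ b) (h : ∀ t > 0, 0 ≤ a + t * b) :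
    0 ≤ a := by
  by_contra! ha
  -- This `t` makes `a + t b = a / (b + 1)`, still negative; the `+ 1` covers `b = 0`.
  have h1 := h (-a / (b + 1)) (div_pos (by linarith) (by linarith))
  have h2 : a + -a / (b + 1) * b = a / (b + 1) := by field_simp; ring
  rw [h2] at h1
  exact absurd h1 (not_le.2 (div_neg_of_neg_of_pos ha (by linarith)))

theorem norm_posPart_le_of_le_abs {f g : L2 Ω} (h : f ≤ |g|) : ‖f⁺‖ ≤ ‖g‖ := by
  refine norm_le_norm_of_abs_le_abs ?_
  rw [abs_of_nonneg (posPart_nonneg f)]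
  exact sup_le h (abs_nonneg g)

/-- The multiplier of the obstacle problem is bounded in the `L²`-norm. -/
theorem IsStateSolution.exists_multiplier_bound
    (hΩ : Bornology.IsBounded (Ω : Set (EuclideanSpace ℝ (Fin n))))
    {ρ : ℝ} (hρ : 0 < ρ) {g₁ g₂ u : H10 Ω} {f : L2 Ω} (h₁ : g₁ ∈ H1Delta Ω)
    (h₂ : g₂ ∈ H1Delta Ω) (hu : IsStateSolution ρ g₁ g₂ f u) :
    ∃ C, ∀ w, ‖multiplier ρ f u w‖ ≤ C * ‖toL2 w‖ := by
  obtain ⟨p₁, hp₁⟩ := h₁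
  obtain ⟨p₂, hp₂⟩ := h₂
  obtain ⟨hu1, hu2⟩ := mem_Ks_iff.1 hu.1
  have hg : toL2 g₁ ≤ toL2 g₂ := hu1.trans hu2
  set C := ‖(toL2 g₁ - f - ρ • p₁)⁺‖ + ‖(f - toL2 g₂ + ρ • p₂)⁺‖ with hC
  have key : ∀ w, 0 ≤ multiplier ρ f u w + C * ‖toL2 w‖ := by
    intro w
    have q1 : 0 ≤ inner ℝ (toL2 w) (toL2 w) := real_inner_self_nonneg
    have q2 : 0 ≤ inner ℝ (grad w) (grad w) := real_inner_self_nonneg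
    -- Here `b` is the quadratic part of the energy in direction `w`: after division by `t`, it is
    -- the only term still carrying a factor `t`.
    refine nonneg_of_forall_pos_add_mul
      (b := ρ / 2 * inner ℝ (grad w) (grad w) + 1 / 2 * inner ℝ (toL2 w) (toL2 w))
      (by positivity) fun t ht => ?_
    obtain ⟨v, hv1, hv2⟩ := exists_clamp_energy_le hΩ hρ f hp₁ hp₂ (u + t • w)
    have hv : v ∈ Ks g₁ g₂ := by
      rw [mem_Ks_iff, hv1]
      exact ⟨le_inf le_sup_right hg, inf_le_right⟩
    have hE := (hu.energy_le hρ hv).trans hv2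
    have hn : ‖toL2 (t • w)‖ = t * ‖toL2 w‖ := by
      rw [map_smul, norm_smul, Real.norm_of_nonneg ht.le]
    -- Since `u` is admissible, `u + t w` can violate either obstacle by at most `t |w|`.
    have b1 : ‖(toL2 g₁ - toL2 (u + t • w))⁺‖ ≤ t * ‖toL2 w‖ := by
      rw [← hn]
      refine norm_posPart_le_of_le_abs ?_
      rw [map_add, sub_add_eq_sub_sub]
      exact (sub_le_sub_right (sub_nonpos.2 hu1) _).trans
        (by rw [zero_sub]; exact neg_le_abs _)
    have b2 : ‖(toL2 (u + t • w) ⊔ toL2 g₁ - toL2 g₂)⁺‖ ≤ t * ‖toL2 w‖ := by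
      rw [← hn]
      refine norm_posPart_le_of_le_abs ?_
      rw [sub_le_iff_le_add, map_add]
      refine sup_le ?_ (hg.trans (le_add_of_nonneg_left (abs_nonneg _)))
      rw [add_comm]
      exact add_le_add (le_abs_self _) hu2
    have c1 := (real_inner_le_norm (toL2 g₁ - f - ρ • p₁)⁺
      (toL2 g₁ - toL2 (u + t • w))⁺).trans (mul_le_mul_of_nonneg_left b1 (norm_nonneg _))
    have c2 := (real_inner_le_norm (f - toL2 g₂ + ρ • p₂)⁺
      (toL2 (u + t • w) ⊔ toL2 g₁ - toL2 g₂)⁺).trans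
        (mul_le_mul_of_nonneg_left b2 (norm_nonneg _))
    rw [energy_add] at hE
    simp only [map_smul, smul_eq_mul, real_inner_smul_left, real_inner_smul_right] at hE
    refine nonneg_of_mul_nonneg_right (a := t) ?_ ht
    rw [hC]
    linarith
  refine ⟨C, fun w => abs_le.2 ⟨by linarith [key w], ?_⟩⟩
  have h := key (-w)
  rw [map_neg, map_neg, norm_neg] at h
  linarith

/-- Such a functional extends continuously from the dense image of `H¹₀` to `L²`, where Riesz
represents it. -/
theorem exists_eq_ofL2 (F : Hneg1 Ω) (hF : ∃ C, ∀ w, ‖F w‖ ≤ C * ‖toL2 w‖) :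
    ∃ l : L2 Ω, F = ofL2 l := by
  refine ⟨(InnerProductSpace.toDual ℝ (L2 Ω)).symm
    (F.toLinearMap.extendOfNorm (toL2 : H10 Ω →L[ℝ] L2 Ω).toLinearMap), ?_⟩
  ext w
  have h := LinearMap.extendOfNorm_eq (f := F.toLinearMap)
    (e := (toL2 : H10 Ω →L[ℝ] L2 Ω).toLinearMap) denseRange_toL2 hF w
  simp only [ofL2, ContinuousLinearMap.comp_apply, innerSL_apply_apply,
    InnerProductSpace.toDual_symm_apply]
  exact h.symm

/-! ### Complementarity. -/

theorem IsStateSolution.multiplier_nonneg {ρ : ℝ} {g₁ g₂ u v : H10 Ω} {f : L2 Ω}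
    (hu : IsStateSolution ρ g₁ g₂ f u) (hv : v ∈ Ks g₁ g₂) :
    0 ≤ multiplier ρ f u (v - u) := by
  have h2 := hu.2 v hv
  have h5 := multiplier_apply ρ f u (v - u)
  linarith

/-- For `w` from `H¹₀` the truncation is itself admissible; both sides are continuous in `w` for the
`L²` norm, so density gives the rest. -/
theorem IsStateSolution.inner_clamp_sub_nonneg
    (hΩ : Bornology.IsBounded (Ω : Set (EuclideanSpace ℝ (Fin n))))
    {ρ : ℝ} (hρ : 0 < ρ) {g₁ g₂ u : H10 Ω} {f : L2 Ω} (h₁ : g₁ ∈ H1Delta Ω)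
    (h₂ : g₂ ∈ H1Delta Ω) (hu : IsStateSolution ρ g₁ g₂ f u) {l : L2 Ω}
    (hl : multiplier ρ f u = ofL2 l) (w : L2 Ω) :
    0 ≤ inner ℝ l ((w ⊔ toL2 g₁) ⊓ toL2 g₂ - toL2 u) := by
  obtain ⟨p₁, hp₁⟩ := h₁
  obtain ⟨p₂, hp₂⟩ := h₂
  obtain ⟨hu1, hu2⟩ := mem_Ks_iff.1 hu.1
  induction w using denseRange_toL2.induction_on with
  | hp =>
    refine isClosed_le continuous_const (continuous_const.inner (Continuous.sub ?_ ?_))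
    · exact (continuous_id.sup continuous_const).inf continuous_const
    · exact continuous_const
  | ih v =>
    obtain ⟨v', hv1, -⟩ := exists_clamp_energy_le hΩ hρ f hp₁ hp₂ v
    have hv : v' ∈ Ks g₁ g₂ := by
      rw [mem_Ks_iff, hv1]
      exact ⟨le_inf le_sup_right (hu1.trans hu2), inf_le_right⟩
    have h := hu.multiplier_nonneg hv
    rw [hl, ofL2, ContinuousLinearMap.comp_apply, innerSL_apply_apply, map_sub, hv1] at h
    exact h

theorem mul_clamp_sub_nonpos {a b u l : ℝ} (hau : a ≤ u) (hub : u ≤ b) :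
    l * (min (max (u - l) a) b - u) ≤ 0 := by
  rcases le_total 0 l with h | h
  · refine mul_nonpos_of_nonneg_of_nonpos h (sub_nonpos.2 ?_)
    exact (min_le_left _ _).trans (max_le (by linarith) hau)
  · refine mul_nonpos_of_nonpos_of_nonneg h (sub_nonneg.2 ?_)
    exact le_min (le_max_of_le_left (by linarith)) hub

theorem complementarity_of_clamp_eq {a b u l : ℝ} (hau : a ≤ u) (hub : u ≤ b) (hab : a < b)
    (h : l = 0 ∨ min (max (u - l) a) b = u) :
    (a < u ∧ u < b → l = 0) ∧ (u = a → 0 ≤ l) ∧ (u = b → l ≤ 0) := by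
  grind

/-- The complementarity conditions. -/
theorem IsStateSolution.ae_complementarity
    (hΩ : Bornology.IsBounded (Ω : Set (EuclideanSpace ℝ (Fin n))))
    {ρ : ℝ} (hρ : 0 < ρ) {g₁ g₂ u : H10 Ω} {f : L2 Ω} (h₁ : g₁ ∈ H1Delta Ω)
    (h₂ : g₂ ∈ H1Delta Ω) (hlt : ∀ᵐ x ∂(vol Ω), toL2 g₁ x < toL2 g₂ x)
    (hu : IsStateSolution ρ g₁ g₂ f u) {l : L2 Ω} (hl : multiplier ρ f u = ofL2 l) :
    ∀ᵐ x ∂(vol Ω),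
      (toL2 g₁ x < toL2 u x ∧ toL2 u x < toL2 g₂ x → l x = 0) ∧
      (toL2 u x = toL2 g₁ x → 0 ≤ l x) ∧ (toL2 u x = toL2 g₂ x → l x ≤ 0) := by
  -- Moving from `u` against `l` and truncating back makes `l w ≤ 0` pointwise, while the
  -- variational inequality makes its integral nonnegative.
  set w : L2 Ω := ((toL2 u - l) ⊔ toL2 g₁) ⊓ toL2 g₂ - toL2 u with hw
  have hwx : ∀ᵐ x ∂(vol Ω),
      w x = min (max (toL2 u x - l x) (toL2 g₁ x)) (toL2 g₂ x) - toL2 u x := by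
    filter_upwards [Lp.coeFn_sub (((toL2 u - l) ⊔ toL2 g₁) ⊓ toL2 g₂) (toL2 u),
      Lp.coeFn_inf ((toL2 u - l) ⊔ toL2 g₁) (toL2 g₂), Lp.coeFn_sup (toL2 u - l) (toL2 g₁),
      Lp.coeFn_sub (toL2 u) l] with x e1 e2 e3 e4
    rw [hw, e1, Pi.sub_apply, e2, Pi.inf_apply, e3, Pi.sup_apply, e4]
    rfl
  have hle : ∀ᵐ x ∂(vol Ω), inner ℝ (l x) (w x) ≤ 0 := by
    filter_upwards [hwx, hu.1] with x e1 e2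
    rw [e1, real_inner_comm]
    exact mul_clamp_sub_nonpos e2.1 e2.2
  have h0 := hu.inner_clamp_sub_nonneg hΩ hρ h₁ h₂ hl (toL2 u - l)
  rw [← hw, L2.inner_def] at h0
  have hzero : ∀ᵐ x ∂(vol Ω), -inner ℝ (l x) (w x) = 0 := by
    refine (integral_eq_zero_iff_of_nonneg_ae ?_ (L2.integrable_inner l w).neg).1 ?_
    · filter_upwards [hle] with x hx
      simpa using hx
    · have := integral_nonpos_of_ae hle
      rw [integral_neg']
      linarith
  filter_upwards [hwx, hu.1, hzero, hlt] with x e1 e2 e3 e4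
  have e5 : l x = 0 ∨ w x = 0 := by
    rw [neg_eq_zero, real_inner_comm] at e3
    exact mul_eq_zero.1 e3
  rw [e1, sub_eq_zero] at e5
  exact complementarity_of_clamp_eq e2.1 e2.2 e4 e5

/-! ### The bound on the inactive set and the conclusion. -/

/-- Testing with `ū` gives `‖u - ū‖² ≤ ρ⟨∇u, ∇(ū - u)⟩ ≤ ρ⟨∇ū, ∇(ū - u)⟩ = ρ⟨q, u - ū⟩`;
Cauchy–Schwarz finishes. -/
theorem IsStateSolution.norm_sub_le {ρ : ℝ} (hρ : 0 < ρ) {g₁ g₂ u ubar : H10 Ω} {q : L2 Ω}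
    (hu : IsStateSolution ρ g₁ g₂ (toL2 ubar) u) (hubar : ubar ∈ Ks g₁ g₂)
    (hq : HasLaplacian ubar q) : ‖toL2 u - toL2 ubar‖ ≤ ρ * ‖q‖ := by
  have h1 := hu.2 ubar hubar
  have h2 := inner_grad_of_hasLaplacian hq (u - ubar)
  have h3 : 0 ≤ inner ℝ (grad (u - ubar)) (grad (u - ubar)) := real_inner_self_nonneg
  have h4 := abs_le.1 (abs_real_inner_le_norm q (toL2 u - toL2 ubar))
  have h5 := real_inner_self_eq_norm_sq (toL2 u - toL2 ubar)
  have h6 := real_inner_comm (grad u) (grad ubar)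
  have h7 := real_inner_comm (toL2 u) (toL2 ubar)
  simp only [map_sub, inner_sub_left, inner_sub_right] at h1 h2 h3 h4 h5
  have h8 : ‖toL2 u - toL2 ubar‖ ^ 2 ≤ ρ * (inner ℝ q (toL2 u) - inner ℝ q (toL2 ubar)) := by
    have e : inner ℝ (grad u) (grad ubar) - inner ℝ (grad u) (grad u) ≤
        inner ℝ q (toL2 u) - inner ℝ q (toL2 ubar) := by linarith
    linarith [mul_le_mul_of_nonneg_left e hρ.le]
  have h9 := h8.trans (mul_le_mul_of_nonneg_left h4.2 hρ.le)
  by_contra! h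
  nlinarith [mul_nonneg hρ.le (norm_nonneg q)]

theorem measurableSet_activeSet (g u : H10 Ω) : MeasurableSet (activeSet g u) :=
  Ω.isOpen.measurableSet.inter (measurableSet_eq_fun
    (Lp.stronglyMeasurable (toL2 u)).measurable (Lp.stronglyMeasurable (toL2 g)).measurable)

end ObstacleControl

open ObstacleControl in
theorem mainTheorem6 {n : ℕ} (Ω : Opens (EuclideanSpace ℝ (Fin n)))
    (hΩ : Bornology.IsBounded (Ω : Set (EuclideanSpace ℝ (Fin n))))
    (gminus gplus : H10 Ω)
    (hgminus : gminus ∈ H1Delta Ω) (hgplus : gplus ∈ H1Delta Ω)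
    (hlt : ∀ᵐ x ∂(vol Ω), toL2 gminus x < toL2 gplus x)
    (hzero : (0 : H10 Ω) ∈ Ks gminus gplus)
    (ubar : H10 Ω) (hubar : ubar ∈ Ks gminus gplus ∩ H1Delta Ω)
    (ρ : ℝ) (hρ : 0 < ρ)
    (u : H10 Ω) (hu : IsStateSolution ρ gminus gplus (toL2 ubar) u) :
    -- `z = -Δu` lies in `L²(Ω)`, and so does the multiplier `-ρ Δu + u - ū`
    (∃ z l : L2 Ω, negLaplacian u = ofL2 z ∧ multiplier ρ (toL2 ubar) u = ofL2 l ∧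
      l = ρ • z + (toL2 u - toL2 ubar)) ∧
    -- the bound on the inactive set
    (∀ lapU lapUbar : L2 Ω, HasLaplacian u lapU → HasLaplacian ubar lapUbar →
      eLpNorm lapU 2 (volume.restrict (inactiveSet gminus gplus u)) ≤
        eLpNorm lapUbar 2 (vol Ω)) ∧
    -- the complementarity conditions
    (∀ l : L2 Ω, multiplier ρ (toL2 ubar) u = ofL2 l →
      ∀ᵐ x ∂(vol Ω),
        (toL2 gminus x < toL2 u x ∧ toL2 u x < toL2 gplus x → l x = 0) ∧
        (toL2 u x = toL2 gminus x → 0 ≤ l x) ∧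
        (toL2 u x = toL2 gplus x → l x ≤ 0)) := by
  refine ⟨?_, ?_, fun l hl => hu.ae_complementarity hΩ hρ hgminus hgplus hlt hl⟩
  · obtain ⟨l, hl⟩ := exists_eq_ofL2 _ (hu.exists_multiplier_bound hΩ hρ hgminus hgplus)
    refine ⟨ρ⁻¹ • (l - (toL2 u - toL2 ubar)), l, ?_, hl, ?_⟩
    · ext w
      have h := congrArg (fun F : Hneg1 Ω => F w) hl
      simp only [multiplier_apply] at h
      change inner ℝ (grad u) (grad w) = inner ℝ (ρ⁻¹ • (l - (toL2 u - toL2 ubar))) (toL2 w)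
      change _ = inner ℝ l (toL2 w) at h
      rw [real_inner_smul_left, inner_sub_left, inner_sub_left, ← h]
      field_simp
      ring
    · rw [smul_inv_smul₀ hρ.ne', sub_add_cancel]
  · intro p q hp hq
    have hl : multiplier ρ (toL2 ubar) u = ofL2 (toL2 u - toL2 ubar - ρ • p) := by
      ext w
      rw [multiplier_apply, inner_grad_of_hasLaplacian hp]
      change _ = inner ℝ (toL2 u - toL2 ubar - ρ • p) (toL2 w)
      rw [inner_sub_left, inner_sub_left, real_inner_smul_left]
      ring
    have hae := hu.ae_complementarity hΩ hρ hgminus hgplus hlt hl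
    -- `d` is the value forced on `Δu` where the multiplier vanishes, and its norm is controlled on
    -- all of `Ω`.
    set d : L2 Ω := ρ⁻¹ • (toL2 u - toL2 ubar) with hd
    have hdq : ‖d‖ ≤ ‖q‖ := by
      rw [hd, norm_smul, norm_inv, Real.norm_of_nonneg hρ.le, inv_mul_le_iff₀ hρ]
      exact hu.norm_sub_le hρ hubar.1 hq
    have hsub : inactiveSet gminus gplus u ⊆ Ω := Set.sdiff_subset
    have hmeas : MeasurableSet (inactiveSet gminus gplus u) :=
      Ω.isOpen.measurableSet.diff
        ((measurableSet_activeSet gplus u).union (measurableSet_activeSet gminus u))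
    have hpd : p =ᵐ[volume.restrict (inactiveSet gminus gplus u)] d := by
      have hpd' : ∀ᵐ x ∂(vol Ω), x ∈ inactiveSet gminus gplus u → p x = d x := by
        filter_upwards [hae, hu.1, Lp.coeFn_sub (toL2 u - toL2 ubar) (ρ • p),
          Lp.coeFn_smul ρ p, Lp.coeFn_smul ρ⁻¹ (toL2 u - toL2 ubar)]
          with x e1 e2 e3 e4 e5 ⟨hx, hx'⟩
        have n1 : toL2 u x ≠ toL2 gplus x := fun h => hx' (Or.inl ⟨hx, h⟩)
        have n2 : toL2 u x ≠ toL2 gminus x := fun h => hx' (Or.inr ⟨hx, h⟩)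
        have e6 := e1.1 ⟨lt_of_le_of_ne e2.1 n2.symm, lt_of_le_of_ne e2.2 n1⟩
        rw [e3, Pi.sub_apply, e4, Pi.smul_apply, smul_eq_mul, sub_eq_zero] at e6
        rw [hd, e5, Pi.smul_apply, smul_eq_mul, e6, inv_mul_cancel_left₀ hρ.ne']
      have h := ae_restrict_of_ae_restrict_of_subset hsub hpd'
      filter_upwards [h, ae_restrict_mem hmeas] with x h1 h2 using h1 h2
    rw [eLpNorm_congr_ae hpd]
    refine (eLpNorm_mono_measure _ (Measure.restrict_mono_set _ hsub)).trans ?_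
    rw [← Lp.enorm_def, ← Lp.enorm_def]
    exact enorm_le_iff_norm_le.2 hdq
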